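/- For $n,k$ let $|E_k\rangle=\sum_{i_1+\dots+i_n=k}|i_1 i_2\dots i_n\rangle\in(\mathbb{C}^{k+1})^{\otimes n}$, where $0\le i_p\le k$. Let $n\ge 3$, let $k_1,\dots,k_K\ge 0$ be integers, and consider $|\Psi\rangle=\bigoplus_{b=1}^K|E_{k_b}\rangle\in(\mathbb{C}^d)^{\otimes n}$ with $\mathbb{C}^d=\bigoplus_{b=1}^K\mathbb{C}^{k_b+1}$; that is, $|\Psi\rangle=\sum_b\sum_{i_1+\dots+i_n=k_b}|i_1^{(b)}\dots i_n^{(b)}\rangle$, where $|i^{(b)}\rangle$, $0\le i\le k_b$, is the standard basis of the $b$-th summand of $\mathbb{C}^d$. A symmetry of a state $|\psi\rangle$ is an operator $S=S^{(1)}\otimes\dots\otimes S^{(n)}$ with invertible $S^{(p)}$ such that $S|\psi\rangle=c|\psi\rangle$ for some $c\in\mathbb{C}\setminus\{0\}$. Then the group of all symmetries of $|\Psi\rangle$ is generated by the following operators: 1. the direct sums $\bigoplus_{b=1}^K S_{b}$, i.e. the operators $\bigotimes_{p=1}^n\bigl(\bigoplus_{b=1}^K S_b^{(p)}\bigr)$,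 where the $S_b=S_b^{(1)}\otimes\dots\otimes S_b^{(n)}$ are symmetries of the individual states with a common factor, $S_b|E_{k_b}\rangle=\alpha|E_{k_b}\rangle$ for all $b$, for some $\alpha\in\mathbb{C}\setminus\{0\}$; 2. the block-wise scalings $D(\vec\gamma_1)\otimes\dots\otimes D(\vec\gamma_n)$, where $D(\vec\gamma_p)=\bigoplus_{b=1}^K(\vec\gamma_p)_b\,\mathbb{1}_{k_b+1}$ with $\vec\gamma_p\in(\mathbb{C}\setminus\{0\})^K$ and $\prod_{p=1}^n(\vec\gamma_p)_b=\gamma$ for all $b$, for some $\gamma\in\mathbb{C}\setminus\{0\}$; 3. the simultaneous permutations $X_\sigma^{\otimes n}$ of blocks of equal size, where $X_\sigma|i^{(b)}\rangle=|i^{(\sigma(b))}\rangle$ and $\sigma$ is a permutation of $\{1,\dots,K\}$ with $k_{\sigma(b)}=k_b$ for all $b$. Moreover, the subgroup of the symmetries with $S|\Psi\rangle=|\Psi\rangle$ is generated by the operators of these three kinds with $\alpha=1$ and $\gamma=1$. -/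

import Mathlib

open scoped TensorProduct

noncomputable section

namespace ESState

/-- The Hilbert space `(ℂ^d)^{⊗ n}` of `n` parties, the standard basis of the local space `ℂ^d`
being indexed by `ι`. -/
abbrev Space (n : ℕ) (ι : Type) : Type := ⨂[ℂ] _ : Fin n, (ι → ℂ)

/-- The computational basis vector `|x₁ x₂ … xₙ⟩`. -/
def ket {n : ℕ} {ι : Type} [DecidableEq ι] (x : Fin n → ι) : Space n ι :=
  PiTensorProduct.tprod ℂ fun p => (Pi.single (x p) 1 : ι → ℂ)

/-- The local operator `A₁ ⊗ A₂ ⊗ … ⊗ Aₙ`, as an invertible operator on `(ℂ^d)^{⊗ n}`; it depends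
multiplicatively on `(A₁, …, Aₙ) ∈ GL(d, ℂ)^n`. -/
def localOp {n : ℕ} {ι : Type} [Fintype ι] [DecidableEq ι] :
    (Fin n → GL ι ℂ) →* LinearMap.GeneralLinearGroup ℂ (Space n ι) :=
  (Units.map PiTensorProduct.mapMonoidHom).comp <|
    (MulEquiv.piUnits (M := fun _ : Fin n => (ι → ℂ) →ₗ[ℂ] (ι → ℂ))).symm.toMonoidHom.comp <|
      MonoidHom.pi fun p =>
        (Matrix.GeneralLinearGroup.toLin (n := ι) (R := ℂ)).toMonoidHom.comp
          (Pi.evalMonoidHom (fun _ : Fin n => GL ι ℂ) p)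

/-- The stabilizer of `ψ`: all local invertible operators `T = A₁ ⊗ … ⊗ Aₙ` with `T ψ = ψ`. -/
def stabilizer {n : ℕ} {ι : Type} [Fintype ι] [DecidableEq ι] (ψ : Space n ι) :
    Subgroup (LinearMap.GeneralLinearGroup ℂ (Space n ι)) where
  carrier := {T | T ∈ (localOp (n := n) (ι := ι)).range ∧ T.val ψ = ψ}
  one_mem' := ⟨one_mem _, rfl⟩
  mul_mem' := by
    rintro S T ⟨hS, hS'⟩ ⟨hT, hT'⟩
    refine ⟨mul_mem hS hT, ?_⟩
    rw [Units.val_mul, Module.End.mul_apply, hT', hS']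
  inv_mem' := by
    rintro T ⟨hT, hT'⟩
    refine ⟨inv_mem hT, ?_⟩
    have h : (T⁻¹).val (T.val ψ) = ψ := by
      rw [← Module.End.mul_apply, Units.inv_mul, Module.End.one_apply]
    rwa [hT'] at h

/-- The symmetries of `ψ` up to a proportionality factor: all local invertible operators
`T = A₁ ⊗ … ⊗ Aₙ` with `T ψ = c ψ` for some nonzero complex number `c`. -/
def symmetryGroup {n : ℕ} {ι : Type} [Fintype ι] [DecidableEq ι] (ψ : Space n ι) :
    Subgroup (LinearMap.GeneralLinearGroup ℂ (Space n ι)) where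
  carrier := {T | T ∈ (localOp (n := n) (ι := ι)).range ∧ ∃ c : ℂˣ, T.val ψ = (c : ℂ) • ψ}
  one_mem' := ⟨one_mem _, 1, by simp⟩
  mul_mem' := by
    rintro S T ⟨hS, c, hS'⟩ ⟨hT, d, hT'⟩
    refine ⟨mul_mem hS hT, d * c, ?_⟩
    rw [Units.val_mul, Module.End.mul_apply, hT', map_smul, hS', smul_smul, Units.val_mul]
  inv_mem' := by
    rintro T ⟨hT, c, hT'⟩
    refine ⟨inv_mem hT, c⁻¹, ?_⟩
    have h : (T⁻¹).val (T.val ψ) = ψ := by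
      rw [← Module.End.mul_apply, Units.inv_mul, Module.End.one_apply]
    rw [hT', map_smul] at h
    calc (T⁻¹).val ψ = ((c⁻¹ : ℂˣ) : ℂ) • ((c : ℂ) • (T⁻¹).val ψ) := by
          rw [smul_smul, Units.inv_mul, one_smul]
      _ = ((c⁻¹ : ℂˣ) : ℂ) • ψ := by rw [h]

/-- The state `|E_k⟩ = ∑_{i₁ + … + iₙ = k} |i₁ … iₙ⟩ ∈ (ℂ^{k+1})^{⊗ n}`. -/
def stateE (n k : ℕ) : Space n (Fin (k + 1)) :=
  ∑ i : Fin n → Fin (k + 1) with ∑ p, (i p : ℕ) = k, ket i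

/-- The standard basis of the local space `⨁_b ℂ^{k_b+1}`; the vector `|i^{(b)}⟩` has
index `⟨b, i⟩`. -/
abbrev BlockIdx {K : ℕ} (k : Fin K → ℕ) : Type := Σ b : Fin K, Fin (k b + 1)

/-- The state `⨁_b |E_{k_b}⟩ ∈ (⨁_b ℂ^{k_b+1})^{⊗ n}`. -/
def stateSumE (n : ℕ) {K : ℕ} (k : Fin K → ℕ) : Space n (BlockIdx k) :=
  ∑ b : Fin K, ∑ i : Fin n → Fin (k b + 1) with ∑ p, (i p : ℕ) = k b,
    ket fun p => (⟨b, i p⟩ : BlockIdx k)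

/-- The block-diagonal matrix `⨁_b M_b` on `⨁_b ℂ^{k_b+1}`. -/
def blockSum {K : ℕ} (k : Fin K → ℕ) : (∀ b, GL (Fin (k b + 1)) ℂ) →* GL (BlockIdx k) ℂ :=
  (Units.map (Matrix.blockDiagonal'RingHom (fun b => Fin (k b + 1)) ℂ).toMonoidHom).comp
    (MulEquiv.piUnits (M := fun b => Matrix (Fin (k b + 1)) (Fin (k b + 1)) ℂ)).symm.toMonoidHom

/-- The block-wise scaling `D(γ) = ⨁_b γ_b 𝟙`. -/
def blockScaling {K : ℕ} (k : Fin K → ℕ) (γ : Fin K → ℂˣ) : GL (BlockIdx k) ℂ :=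
  blockSum k fun b => Matrix.GeneralLinearGroup.scalar (Fin (k b + 1)) (γ b)

/-- The permutation `|i^{(b)}⟩ ↦ |i^{(σ b)}⟩` of the standard basis that is induced by a permutation
`σ` of blocks of equal size. -/
def blockPerm {K : ℕ} (k : Fin K → ℕ) (σ : Equiv.Perm (Fin K)) (hσ : ∀ b, k (σ b) = k b) :
    Equiv.Perm (BlockIdx k) :=
  Equiv.sigmaCongr σ fun b => finCongr (congrArg (· + 1) (hσ b).symm)

/-- The permutation matrix `∑_x |π x⟩⟨x|`. -/
def permGL {ι : Type} [Fintype ι] [DecidableEq ι] (π : Equiv.Perm ι) : GL ι ℂ where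
  val := Matrix.of fun x y => if x = π y then 1 else 0
  inv := Matrix.of fun x y => if π x = y then 1 else 0
  val_inv := by
    ext x y
    have h : ∀ j, (π j = y ↔ j = π.symm y) := fun j => by
      rw [Equiv.eq_symm_apply]
    simp [Matrix.mul_apply, Matrix.one_apply, h]
  inv_val := by
    ext x y
    simp [Matrix.mul_apply, Matrix.one_apply]

/-- Generators of the first kind: `⨁_b S_b = ⨂_p (⨁_b S_b^{(p)})`, where for every block `b` the
local operator `S_b = ⨂_p S_b^{(p)}` satisfies `S_b |E_{k_b}⟩ = α |E_{k_b}⟩`. -/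
def directSums (n : ℕ) {K : ℕ} (k : Fin K → ℕ) (α : ℂˣ) :
    Set (LinearMap.GeneralLinearGroup ℂ (Space n (BlockIdx k))) :=
  {T | ∃ S : ∀ b, Fin n → GL (Fin (k b + 1)) ℂ,
      (∀ b, (localOp (S b)).val (stateE n (k b)) = (α : ℂ) • stateE n (k b)) ∧
      T = localOp fun p => blockSum k fun b => S b p}

/-- Generators of the second kind: `⨂_p D(γ_p)` with `∏_p (γ_p)_b = c` for every block `b`. -/
def scalings (n : ℕ) {K : ℕ} (k : Fin K → ℕ) (c : ℂˣ) :
    Set (LinearMap.GeneralLinearGroup ℂ (Space n (BlockIdx k))) :=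
  {T | ∃ γ : Fin n → Fin K → ℂˣ, (∀ b, ∏ p, γ p b = c) ∧
      T = localOp fun p => blockScaling k (γ p)}

/-- Generators of the third kind: `X_σ^{⊗ n}` for the permutations `σ` of blocks of equal size. -/
def permutations (n : ℕ) {K : ℕ} (k : Fin K → ℕ) :
    Set (LinearMap.GeneralLinearGroup ℂ (Space n (BlockIdx k))) :=
  {T | ∃ (σ : Equiv.Perm (Fin K)) (hσ : ∀ b, k (σ b) = k b),
      T = localOp fun _ => permGL (blockPerm k σ hσ)}

end ESState

end

/-! Read `ℂ^{k+1}` as `ℂ[X]/(X^{k+1})` through monomials. Pairing `|E_k⟩` with `v₁ ⊗ … ⊗ vₙ` then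
gives the top coefficient of the product `v₁ ⋯ vₙ`, and `|Ψ⟩` becomes the form `φ(r₁ ⋯ rₙ)` on `R =
∏_b ℂ[X]/(X^{k_b+1})`, with `φ` the sum of top coefficients. This `φ` is nondegenerate, so `R` is a
Frobenius algebra. A symmetry, acting on row vectors, preserves this form up to a factor. For `n ≥
3` this forces each local factor to be a multiplication composed with one common automorphism `θ` of
`R` (`exists_algEquiv_of_preserves_form`). Every factor of `R` has only the idempotents 0 and 1, so
`θ` permutes the block idempotents, and comparing dimensions shows that blocks of equal size are
exchanged. Undoing the permutation leaves block-diagonal matrices, which scale `|Ψ⟩` by `c` exactly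
when each block scales its `|E_{k_b}⟩` by `c`. Hence every symmetry is a direct sum times the
inverse of a block permutation. -/

open scoped TensorProduct
noncomputable section
namespace ESState

/-! ### Product functionals and local operators -/

section Pairing

variable {n : ℕ} {ι : Type} [Fintype ι]

/-- The functional `⟨v₁| ⊗ … ⊗ ⟨vₙ|` (without complex conjugation). -/
def pairing (v : Fin n → ι → ℂ) : Space n ι →ₗ[ℂ] ℂ :=
  PiTensorProduct.lift
    ((MultilinearMap.mkPiAlgebra ℂ (Fin n) ℂ).compLinearMap fun p => dotProductBilin ℂ ℂ (v p))

theorem pairing_tprod (v x : Fin n → ι → ℂ) :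
    pairing v (PiTensorProduct.tprod ℂ x) = ∏ p, v p ⬝ᵥ x p := by
  simp [pairing, dotProductBilin]

variable [DecidableEq ι]

theorem pairing_ket (v : Fin n → ι → ℂ) (x : Fin n → ι) :
    pairing v (ket x) = ∏ p, v p (x p) := by
  simp [ket, pairing_tprod]

/-- The functionals built from standard basis vectors are the coordinates of the tensor product
basis. -/
theorem ext_pairing {s t : Space n ι} (h : ∀ v, pairing v s = pairing v t) : s = t := by
  have key : ∀ x : Fin n → ι, pairing (fun p => Pi.single (x p) 1)
      = (Basis.piTensorProduct fun _ : Fin n => Pi.basisFun ℂ ι).coord x := by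
    intro x
    ext y
    simp [pairing_tprod, Basis.piTensorProduct_repr_tprod_apply, Pi.single_apply, eq_comm]
  refine (Basis.piTensorProduct fun _ : Fin n => Pi.basisFun ℂ ι).ext_elem fun x => ?_
  simpa [key] using h fun p => Pi.single (x p) 1

theorem localOp_tprod (A : Fin n → GL ι ℂ) (x : Fin n → ι → ℂ) :
    (localOp A).val (PiTensorProduct.tprod ℂ x)
      = PiTensorProduct.tprod ℂ fun p => (A p).val.mulVec (x p) := by
  simp only [localOp, MonoidHom.comp_apply, Units.coe_map]
  exact PiTensorProduct.map_tprod _ _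

theorem pairing_localOp (A : Fin n → GL ι ℂ) (v : Fin n → ι → ℂ) (t : Space n ι) :
    pairing v ((localOp A).val t) = pairing (fun p => Matrix.vecMul (v p) (A p).val) t := by
  have : (pairing v).comp (localOp A).val
      = pairing (fun p => Matrix.vecMul (v p) (A p).val) := by
    refine PiTensorProduct.ext (MultilinearMap.ext fun x => ?_)
    simp [localOp_tprod, pairing_tprod, Matrix.dotProduct_mulVec]
  exact LinearMap.congr_fun this t

theorem vecMul_permGL (π : Equiv.Perm ι) (v : ι → ℂ) :
    Matrix.vecMul v (permGL π).val = fun y => v (π y) := by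
  ext y
  simp [permGL, Matrix.vecMul, dotProduct]

end Pairing

/-! ### The three kinds of generators acting on the states -/

section Pairing

variable {n K : ℕ}

theorem pairing_stateE (k : ℕ) (v : Fin n → Fin (k + 1) → ℂ) :
    pairing v (stateE n k)
      = ∑ i : Fin n → Fin (k + 1) with ∑ p, (i p : ℕ) = k, ∏ p, v p (i p) := by
  simp [stateE, pairing_ket]

theorem pairing_stateSumE (k : Fin K → ℕ) (v : Fin n → BlockIdx k → ℂ) :
    pairing v (stateSumE n k) = ∑ b, pairing (fun p i => v p ⟨b, i⟩) (stateE n (k b)) := by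
  simp [stateSumE, pairing_ket, pairing_stateE]

theorem pairing_stateE_finCongr {k l : ℕ} (h : k = l) (h' : k + 1 = l + 1)
    (v : Fin n → Fin (l + 1) → ℂ) :
    pairing (fun p i => v p (finCongr h' i)) (stateE n k) = pairing v (stateE n l) := by
  subst h
  rfl

theorem vecMul_blockSum (k : Fin K → ℕ) (S : ∀ b, GL (Fin (k b + 1)) ℂ) (v : BlockIdx k → ℂ)
    (b : Fin K) (i : Fin (k b + 1)) :
    Matrix.vecMul v (blockSum k S).val ⟨b, i⟩
      = Matrix.vecMul (fun j => v ⟨b, j⟩) (S b).val i := by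
  have h : (blockSum k S).val = Matrix.blockDiagonal' fun b => (S b).val := rfl
  rw [h]
  simp only [Matrix.vecMul, dotProduct, Fintype.sum_sigma]
  rw [Finset.sum_eq_single b]
  · simp
  · intro c _ hc
    simp [Matrix.blockDiagonal'_apply_ne _ _ _ hc]
  · simp

theorem pairing_blockSum (k : Fin K → ℕ) (S : ∀ b, Fin n → GL (Fin (k b + 1)) ℂ)
    (v : Fin n → BlockIdx k → ℂ) :
    pairing v ((localOp fun p => blockSum k fun b => S b p).val (stateSumE n k))
      = ∑ b, pairing (fun p i => v p ⟨b, i⟩) ((localOp (S b)).val (stateE n (k b))) := by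
  simp only [pairing_localOp, pairing_stateSumE, vecMul_blockSum]

/-- Functionals supported on one block isolate that block's equation. With no parties there would be
no factor to kill the other blocks, hence `n ≠ 0`. -/
theorem localOp_blockSum_stateSumE_iff (hn : n ≠ 0) (k : Fin K → ℕ)
    (S : ∀ b, Fin n → GL (Fin (k b + 1)) ℂ) (c : ℂ) :
    (localOp fun p => blockSum k fun b => S b p).val (stateSumE n k) = c • stateSumE n k ↔
      ∀ b, (localOp (S b)).val (stateE n (k b)) = c • stateE n (k b) := by
  constructor
  · intro h b
    refine ext_pairing fun v => ?_
    let w : Fin n → BlockIdx k → ℂ := fun p x => if hx : x.1 = b then v p (hx ▸ x.2) else 0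
    have hw : (fun p i => w p ⟨b, i⟩) = v := by
      funext p i
      simp [w]
    have hw' : ∀ b' ≠ b, pairing (fun p i => w p ⟨b', i⟩) = 0 := by
      intro b' hb'
      refine PiTensorProduct.ext (MultilinearMap.ext fun x => ?_)
      rw [LinearMap.compMultilinearMap_apply, pairing_tprod]
      refine Finset.prod_eq_zero (Finset.mem_univ ⟨0, Nat.pos_of_ne_zero hn⟩) ?_
      simp [w, hb', dotProduct]
    have key := congrArg (pairing w) h
    rw [pairing_blockSum, map_smul, pairing_stateSumE, Finset.sum_eq_single b,
      Finset.sum_eq_single b, hw, ← map_smul] at key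
    · exact key
    · intro b' _ hb'
      simp [hw' b' hb']
    · simp
    · intro b' _ hb'
      simp [hw' b' hb']
    · simp
  · intro h
    refine ext_pairing fun v => ?_
    simp only [pairing_blockSum, h, map_smul, pairing_stateSumE, Finset.smul_sum]

theorem localOp_scalar {k : ℕ} (γ : Fin n → ℂˣ) (t : Space n (Fin (k + 1))) :
    (localOp fun p => Matrix.GeneralLinearGroup.scalar (Fin (k + 1)) (γ p)).val t
      = ((∏ p, γ p : ℂˣ) : ℂ) • t := by
  have : (localOp fun p => Matrix.GeneralLinearGroup.scalar (Fin (k + 1)) (γ p)).val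
      = ((∏ p, γ p : ℂˣ) : ℂ) • LinearMap.id := by
    refine PiTensorProduct.ext (MultilinearMap.ext fun x => ?_)
    have h : (fun p => (Matrix.GeneralLinearGroup.scalar (Fin (k + 1)) (γ p)).val.mulVec (x p))
        = fun p => (γ p : ℂ) • x p := by
      funext p
      ext i
      simp [Matrix.mulVec_diagonal]
    rw [LinearMap.compMultilinearMap_apply, localOp_tprod, h, MultilinearMap.map_smul_univ]
    simp
  rw [this]
  rfl

/-- On each block a scaling is a scalar, so the second kind of generator is redundant. -/
theorem scalings_subset_directSums (k : Fin K → ℕ) (c : ℂˣ) :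
    scalings n k c ⊆ directSums n k c := by
  rintro T ⟨γ, hγ, rfl⟩
  refine ⟨fun b p => Matrix.GeneralLinearGroup.scalar _ (γ p b), fun b => ?_, rfl⟩
  rw [localOp_scalar, hγ]

theorem permutations_stateSumE (k : Fin K → ℕ) (σ : Equiv.Perm (Fin K))
    (hσ : ∀ b, k (σ b) = k b) :
    (localOp fun _ => permGL (blockPerm k σ hσ)).val (stateSumE n k) = stateSumE n k := by
  refine ext_pairing fun v => ?_
  rw [pairing_localOp, pairing_stateSumE, pairing_stateSumE,
    ← Equiv.sum_comp σ fun b => pairing (fun p i => v p ⟨b, i⟩) (stateE n (k b))]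
  refine Finset.sum_congr rfl fun b _ => ?_
  rw [← pairing_stateE_finCongr (hσ b).symm (congrArg (· + 1) (hσ b).symm)]
  simp only [vecMul_permGL]
  rfl

end Pairing
end ESState
end
noncomputable section

namespace ESState

/-! ### Frobenius forms and automorphisms of product algebras -/

section Algebra

variable {F R : Type*} [Field F] [CommRing R] [Algebra F R]

/-- Local operators that preserve the form `φ (r₁ ⋯ rₙ)` of a Frobenius algebra up to a factor
differ from a common algebra automorphism by multiplications only. -/
theorem exists_algEquiv_of_preserves_form {n : ℕ} (hn : 3 ≤ n) (φ : R →ₗ[F] F)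
    (hφ : ∀ f, (∀ g, φ (f * g) = 0) → f = 0) (c : F) (B : Fin n → R ≃ₗ[F] R)
    (h : ∀ r : Fin n → R, φ (∏ p, B p (r p)) = c * φ (∏ p, r p)) :
    ∃ (θ : R ≃ₐ[F] R) (u : Fin n → R), ∀ p x, B p x = u p * θ x := by
  have form : ∀ p q, p ≠ q → ∀ t, ∃ w, ∀ x y, φ (B p x * B q y * t) = c * φ (x * y * w) := by
    intro p q hpq t
    obtain ⟨s, hs⟩ : ∃ s, s ∉ ({p, q} : Finset (Fin n)) := by
      by_contra! hall
      have := Finset.card_le_card (fun s _ => hall s : (Finset.univ : Finset (Fin n)) ⊆ {p, q})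
      have := Finset.card_le_two (a := p) (b := q)
      simp at *
      omega
    simp only [Finset.mem_insert, Finset.mem_singleton, not_or] at hs
    -- A third party `s` supplies the test element `t`; all the others receive preimages of 1, so
    -- they disappear on the left-hand side.
    let r : R → R → Fin n → R := fun x y j =>
      if j = p then x else if j = q then y else (B j).symm (if j = s then t else 1)
    have split : ∀ g : Fin n → R,
        ∏ j, g j = g p * g q * ∏ j ∈ (Finset.univ.erase p).erase q, g j := by
      intro g
      rw [mul_assoc, Finset.mul_prod_erase _ _ (by simp [Ne.symm hpq]),
        Finset.mul_prod_erase _ _ (by simp)]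
    -- The zeros are placeholders: the parties `p` and `q` are left out of this product.
    refine ⟨∏ j ∈ (Finset.univ.erase p).erase q, r 0 0 j, fun x y => ?_⟩
    have e1 : ∏ j ∈ (Finset.univ.erase p).erase q, r x y j
        = ∏ j ∈ (Finset.univ.erase p).erase q, r 0 0 j := by
      refine Finset.prod_congr rfl fun j hj => ?_
      simp only [Finset.mem_erase, Finset.mem_univ, and_true] at hj
      simp [r, hj.1, hj.2]
    have e2 : ∏ j ∈ (Finset.univ.erase p).erase q, B j (r x y j) = t := by
      have : ∏ j ∈ (Finset.univ.erase p).erase q, B j (r x y j)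
          = ∏ j ∈ (Finset.univ.erase p).erase q, if j = s then t else 1 := by
        refine Finset.prod_congr rfl fun j hj => ?_
        simp only [Finset.mem_erase, Finset.mem_univ, and_true] at hj
        simp [r, hj.1, hj.2]
      rw [this, Finset.prod_ite_eq']
      simp [hs.1, hs.2]
    have key := h (r x y)
    rw [split, split (r x y), e1, e2] at key
    simpa [r, hpq.symm] using key
  -- By nondegeneracy, `B p x * B q y` depends on `x * y` only.
  have cocycle : ∀ p q, p ≠ q → ∀ x y x' y', x * y = x' * y' → B p x * B q y = B p x' * B q y' := by
    intro p q hpq x y x' y' hxy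
    refine sub_eq_zero.mp (hφ _ fun t => ?_)
    obtain ⟨w, hw⟩ := form p q hpq t
    rw [sub_mul, map_sub, hw, hw, hxy, sub_self]
  have other : ∀ p : Fin n, ∃ q, p ≠ q := by
    intro p
    have : Nontrivial (Fin n) := Fin.nontrivial_iff_two_le.mpr (by omega)
    obtain ⟨q, hq⟩ := exists_ne p
    exact ⟨q, hq.symm⟩
  have unit : ∀ q, IsUnit (B q 1) := by
    intro q
    obtain ⟨p, hp⟩ := other q
    have := cocycle p q hp.symm ((B p).symm 1 * (B q).symm 1) 1 ((B p).symm 1) ((B q).symm 1)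
      (by ring)
    rw [LinearEquiv.apply_symm_apply, LinearEquiv.apply_symm_apply, one_mul] at this
    exact IsUnit.of_mul_eq_one_right _ this
  let p₀ : Fin n := ⟨0, by omega⟩
  obtain ⟨q₀, hq₀⟩ := other p₀
  obtain ⟨u₀, hu₀⟩ := unit p₀
  obtain ⟨u₁, hu₁⟩ := unit q₀
  have swap : ∀ q y, B q y * B p₀ 1 = B q 1 * B p₀ y := by
    intro q y
    by_cases hq : q = p₀
    · rw [hq, mul_comm]
    · exact cocycle q p₀ hq y 1 1 y (by ring)
  -- Dividing by the unit `B p₀ 1` normalises the map to send 1 to 1; `swap` shows that every party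
  -- yields the same map.
  let Θ : R ≃ₗ[F] R := (B p₀).trans
    { toFun := fun x => ↑u₀⁻¹ * x
      invFun := fun x => ↑u₀ * x
      map_add' := fun x y => mul_add _ _ _
      map_smul' := fun a x => by simp
      left_inv := fun x => by simp
      right_inv := fun x => by simp }
  have hΘ : ∀ x, Θ x = ↑u₀⁻¹ * B p₀ x := fun x => rfl
  have hB : ∀ q y, B q y = B q 1 * Θ y := by
    intro q y
    have := swap q y
    rw [← hu₀] at this
    rw [hΘ, ← mul_assoc, mul_comm (B q 1), mul_assoc, ← this, mul_comm (B q y), ← mul_assoc,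
      Units.inv_mul, one_mul]
  refine ⟨AlgEquiv.ofLinearEquiv Θ ?_ ?_, fun q => B q 1, hB⟩
  · rw [hΘ, ← hu₀, Units.inv_mul]
  · intro x y
    have := cocycle p₀ q₀ hq₀ (x * y) 1 x y (by ring)
    rw [hB q₀ y, ← hu₁, mul_comm (u₁ : R) (Θ y), ← mul_assoc] at this
    rw [hΘ, hΘ x, u₁.isUnit.mul_right_cancel this, mul_assoc]

/-- In each coordinate, the images of the block idempotents are 0 or 1, mutually orthogonal and of
sum 1, so exactly one is 1. This gives a map from target to source blocks, surjective because `θ` is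
injective; `σ` is its inverse. -/
theorem exists_perm_of_algEquiv_pi {κ : Type*} [Fintype κ] [DecidableEq κ] {A : κ → Type*}
    [∀ b, CommRing (A b)] [∀ b, Nontrivial (A b)] [∀ b, Algebra F (A b)]
    (hid : ∀ b (x : A b), x * x = x → x = 0 ∨ x = 1) (θ : (∀ b, A b) ≃ₐ[F] ∀ b, A b) :
    ∃ σ : Equiv.Perm κ, ∀ b, θ (Pi.single b 1) = Pi.single (σ b) 1 := by
  have h01 : ∀ b c, θ (Pi.single b 1) c = 0 ∨ θ (Pi.single b 1) c = 1 := by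
    intro b c
    apply hid
    rw [← Pi.mul_apply, ← map_mul, ← Pi.single_mul, one_mul]
  have ortho : ∀ b b' c, b ≠ b' → θ (Pi.single b 1) c * θ (Pi.single b' 1) c = 0 := by
    intro b b' c hb
    rw [← Pi.mul_apply, ← map_mul]
    have : (Pi.single b 1 * Pi.single b' 1 : ∀ b, A b) = 0 := by
      ext d
      by_cases hd : d = b
      · subst hd
        simp [Pi.single_eq_of_ne hb]
      · simp [Pi.single_eq_of_ne hd]
    rw [this, map_zero, Pi.zero_apply]
  have total : ∀ c, ∑ b, θ (Pi.single b 1) c = 1 := by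
    intro c
    rw [← Finset.sum_apply, ← map_sum]
    have : (∑ b, Pi.single b 1 : ∀ b, A b) = 1 := Finset.univ_sum_single 1
    rw [this, map_one, Pi.one_apply]
  have ex : ∀ c, ∃ b, θ (Pi.single b 1) c = 1 := by
    intro c
    by_contra! hne
    have := total c
    rw [Finset.sum_eq_zero fun b _ => (h01 b c).resolve_right (hne b)] at this
    exact zero_ne_one this
  choose τ hτ using ex
  have hτ' : ∀ b c, b ≠ τ c → θ (Pi.single b 1) c = 0 := by
    intro b c hb
    simpa [hτ] using ortho b (τ c) c hb
  have surj : Function.Surjective τ := by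
    intro b
    by_contra! hne
    have : θ (Pi.single b 1) = 0 := funext fun c => hτ' b c (hne c).symm
    rw [map_eq_zero_iff θ θ.injective] at this
    simpa using congrFun this b
  let T := Equiv.ofBijective τ ⟨Finite.injective_iff_surjective.mpr surj, surj⟩
  refine ⟨T.symm, fun b => funext fun c => ?_⟩
  by_cases hc : c = T.symm b
  · subst hc
    have : τ (T.symm b) = b := T.apply_symm_apply b
    rw [Pi.single_eq_same]
    have h := hτ (T.symm b)
    rwa [this] at h
  · rw [Pi.single_eq_of_ne hc]
    refine hτ' b c fun hb => hc ?_
    rw [hb]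
    exact (T.symm_apply_apply c).symm

theorem algEquiv_pi_single_apply_ne {κ : Type*} [DecidableEq κ] {A : κ → Type*}
    [∀ b, CommRing (A b)] [∀ b, Algebra F (A b)] (θ : (∀ b, A b) ≃ₐ[F] ∀ b, A b)
    {b d : κ} (h : θ (Pi.single b 1) = Pi.single d 1) (a : A b) {c : κ} (hc : c ≠ d) :
    θ (Pi.single b a) c = 0 := by
  have : (Pi.single b a : ∀ b, A b) = Pi.single b 1 * Pi.single b a := by
    rw [← Pi.single_mul, one_mul]
  rw [this, map_mul, h, Pi.mul_apply, Pi.single_eq_of_ne hc, zero_mul]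

/-- `θ` carries the factor `b` into the factor `d`, injectively. -/
theorem finrank_le_of_algEquiv_pi {κ : Type*} [DecidableEq κ] {A : κ → Type*}
    [∀ b, CommRing (A b)] [∀ b, Algebra F (A b)] [∀ b, Module.Finite F (A b)]
    (θ : (∀ b, A b) ≃ₐ[F] ∀ b, A b)
    {b d : κ} (h : θ (Pi.single b 1) = Pi.single d 1) :
    Module.finrank F (A b) ≤ Module.finrank F (A d) := by
  let L : A b →ₗ[F] A d :=
    (LinearMap.proj d).comp (θ.toLinearMap.comp (LinearMap.single F A b))
  refine LinearMap.finrank_le_finrank_of_injective (f := L) ?_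
  rw [injective_iff_map_eq_zero]
  intro a ha
  have : θ (Pi.single b a) = 0 := by
    funext c
    by_cases hc : c = d
    · subst hc
      exact ha
    · exact algEquiv_pi_single_apply_ne θ h a hc
  rw [map_eq_zero_iff θ θ.injective] at this
  simpa using congrFun this b

end Algebra

section TruncPoly

/-! ### The truncated polynomial algebra -/

open Polynomial

/-- The algebra `ℂ[X] / (X^{k+1})`. -/
abbrev TruncPoly (k : ℕ) : Type := ℂ[X] ⧸ Ideal.span {(X ^ (k + 1) : ℂ[X])}

namespace TruncPoly

variable {k : ℕ}

/-- The class of a polynomial. -/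
def mk : ℂ[X] →ₐ[ℂ] TruncPoly k := Ideal.Quotient.mkₐ ℂ _

theorem mk_surjective : Function.Surjective (mk (k := k)) := Ideal.Quotient.mk_surjective

theorem mk_eq_zero_iff {q : ℂ[X]} : mk (k := k) q = 0 ↔ ∀ d ≤ k, q.coeff d = 0 := by
  have : mk (k := k) q = 0 ↔ X ^ (k + 1) ∣ q := by
    rw [← Ideal.mem_span_singleton]
    exact Ideal.Quotient.eq_zero_iff_mem
  simp only [this, X_pow_dvd_iff, Nat.lt_succ_iff]

theorem mk_eq_mk_iff {q r : ℂ[X]} :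
    mk (k := k) q = mk r ↔ ∀ d ≤ k, q.coeff d = r.coeff d := by
  rw [← sub_eq_zero, ← map_sub, mk_eq_zero_iff]
  simp [sub_eq_zero]

instance : Nontrivial (TruncPoly k) := by
  refine ⟨⟨mk 1, mk 0, fun h => ?_⟩⟩
  simpa using mk_eq_mk_iff.mp h 0 (Nat.zero_le _)

/-- The polynomial with the coefficients `v`. -/
def ofCoeffs : (Fin (k + 1) → ℂ) →ₗ[ℂ] ℂ[X] := ∑ i : Fin (k + 1), (monomial (i : ℕ)).comp (LinearMap.proj i)

theorem ofCoeffs_apply (v : Fin (k + 1) → ℂ) : ofCoeffs v = ∑ i : Fin (k + 1), monomial (i : ℕ) (v i) := by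
  simp [ofCoeffs]

theorem coeff_ofCoeffs (v : Fin (k + 1) → ℂ) (i : Fin (k + 1)) :
    (ofCoeffs v).coeff i = v i := by
  simp [ofCoeffs_apply, coeff_monomial, Fin.val_inj]

/-- The monomial basis identifies `ℂ^{k+1}` with `ℂ[X] / (X^{k+1})`. -/
def coeffEquiv : (Fin (k + 1) → ℂ) ≃ₗ[ℂ] TruncPoly k :=
  LinearEquiv.ofBijective (mk.toLinearMap.comp ofCoeffs) <| by
    constructor
    · intro v w h
      ext i
      rw [← coeff_ofCoeffs v, ← coeff_ofCoeffs w]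
      exact mk_eq_mk_iff.mp h i (Nat.lt_succ_iff.mp i.2)
    · intro a
      obtain ⟨q, rfl⟩ := mk_surjective a
      refine ⟨fun i => q.coeff i, mk_eq_mk_iff.mpr fun d hd => ?_⟩
      exact coeff_ofCoeffs (fun i : Fin (k + 1) => q.coeff i) ⟨d, Nat.lt_succ_iff.mpr hd⟩

theorem coeffEquiv_apply (v : Fin (k + 1) → ℂ) : coeffEquiv v = mk (ofCoeffs v) := rfl

theorem coeffEquiv_symm_mk (q : ℂ[X]) (i : Fin (k + 1)) : coeffEquiv.symm (mk q) i = q.coeff i := by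
  obtain ⟨v, hv⟩ := coeffEquiv.surjective (mk q)
  rw [← hv, LinearEquiv.symm_apply_apply, ← coeff_ofCoeffs v]
  rw [coeffEquiv_apply] at hv
  exact mk_eq_mk_iff.mp hv i (Nat.lt_succ_iff.mp i.2)

/-- The coefficient of `X^k`. -/
def topCoeff : TruncPoly k →ₗ[ℂ] ℂ := (LinearMap.proj (Fin.last k)).comp coeffEquiv.symm.toLinearMap

theorem topCoeff_mk (q : ℂ[X]) : topCoeff (mk (k := k) q) = q.coeff k :=
  coeffEquiv_symm_mk q (Fin.last k)

/-- Multiplying by `X^(k-d)` moves the coefficient of degree `d` to the top. -/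
theorem eq_zero_of_topCoeff_mul {f : TruncPoly k} (h : ∀ g, topCoeff (f * g) = 0) : f = 0 := by
  obtain ⟨q, rfl⟩ := mk_surjective f
  refine mk_eq_zero_iff.mpr fun d hd => ?_
  have := h (mk (X ^ (k - d)))
  rw [← map_mul, topCoeff_mk, coeff_mul_X_pow', if_pos (by omega)] at this
  rwa [Nat.sub_sub_self hd] at this

/-- An idempotent equals its own power of exponent `k + 1`, which is divisible by `X^(k+1)` when the
constant term vanishes. -/
theorem eq_zero_of_coeff_zero {q : ℂ[X]} (h0 : q.coeff 0 = 0)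
    (h : mk (k := k) q * mk q = mk q) : mk (k := k) q = 0 := by
  obtain ⟨r, rfl⟩ := X_dvd_iff.mpr h0
  have hi : IsIdempotentElem (mk (k := k) (X * r)) := h
  rw [← hi.pow_succ_eq k, ← map_pow, mul_pow]
  refine mk_eq_zero_iff.mpr fun d hd => ?_
  rw [coeff_X_pow_mul', if_neg (by omega)]

theorem eq_zero_or_one_of_mul_self (f : TruncPoly k) (h : f * f = f) : f = 0 ∨ f = 1 := by
  obtain ⟨q, rfl⟩ := mk_surjective f
  have h0 : q.coeff 0 * q.coeff 0 = q.coeff 0 := by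
    rw [← map_mul] at h
    rw [← mul_coeff_zero]
    exact mk_eq_mk_iff.mp h 0 (Nat.zero_le _)
  by_cases hq : q.coeff 0 = 0
  · exact Or.inl (eq_zero_of_coeff_zero hq h)
  · right
    -- The constant term of `q` is 1, so the previous case applies to the complementary idempotent.
    have h1 : (1 - q).coeff 0 = 0 := by
      simp [mul_left_cancel₀ hq (h0.trans (mul_one _).symm)]
    have := eq_zero_of_coeff_zero (k := k) h1 (by
      rw [map_sub, map_one]
      linear_combination h)
    rw [map_sub, map_one, sub_eq_zero] at this
    exact this.symm

instance : Module.Finite ℂ (TruncPoly k) := Module.Finite.equiv coeffEquiv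

theorem finrank_eq : Module.finrank ℂ (TruncPoly k) = k + 1 := by
  rw [← coeffEquiv.finrank_eq, Module.finrank_fin_fun]

/-- Link between states and algebra: expanding the product, the monomials of total degree `k` are
exactly the kets occurring in `|E_k⟩`. -/
theorem topCoeff_prod_coeffEquiv {n : ℕ} (v : Fin n → Fin (k + 1) → ℂ) :
    topCoeff (∏ p, coeffEquiv (v p))
      = ∑ i : Fin n → Fin (k + 1) with ∑ p, (i p : ℕ) = k, ∏ p, v p (i p) := by
  have hm : ∀ i : Fin n → Fin (k + 1), ∏ p, monomial (i p : ℕ) (v p (i p))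
      = monomial (∑ p, (i p : ℕ)) (∏ p, v p (i p)) := by
    intro i
    simp only [← C_mul_X_pow_eq_monomial, Finset.prod_mul_distrib, Finset.prod_pow_eq_pow_sum,
      map_prod]
  simp only [coeffEquiv_apply, ← map_prod, topCoeff_mk, ofCoeffs_apply]
  rw [Finset.prod_univ_sum, Fintype.piFinset_univ, finsetSum_coeff, Finset.sum_filter]
  simp only [hm, coeff_monomial]

end TruncPoly
end TruncPoly
end ESState
end
noncomputable section
namespace ESState

/-! ### Block structure of the symmetries -/

section Symmetries

variable {n K : ℕ}

/-- The monomial bases identify `⨁_b ℂ^{k_b+1}` with the algebra `∏_b ℂ[X] / (X^{k_b+1})`. -/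
def blockEquiv (k : Fin K → ℕ) : (BlockIdx k → ℂ) ≃ₗ[ℂ] ∀ b, TruncPoly (k b) :=
  (LinearEquiv.piCurry ℂ fun (b : Fin K) (_ : Fin (k b + 1)) => ℂ).trans
    (LinearEquiv.piCongrRight fun _ => TruncPoly.coeffEquiv)

theorem blockEquiv_apply (k : Fin K → ℕ) (v : BlockIdx k → ℂ) (b : Fin K) :
    blockEquiv k v b = TruncPoly.coeffEquiv fun i => v ⟨b, i⟩ := rfl

theorem blockEquiv_single (k : Fin K → ℕ) (b : Fin K) (i : Fin (k b + 1)) :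
    blockEquiv k (Pi.single ⟨b, i⟩ 1) = Pi.single b (TruncPoly.coeffEquiv (Pi.single i 1)) := by
  funext c
  rw [blockEquiv_apply]
  by_cases hc : c = b
  · subst hc
    rw [Pi.single_eq_same]
    congr 1
    funext j
    simp [Pi.single_apply]
  · rw [Pi.single_eq_of_ne hc]
    have : (fun j => (Pi.single ⟨b, i⟩ 1 : BlockIdx k → ℂ) ⟨c, j⟩) = 0 := by
      funext j
      simp [hc]
    rw [this, map_zero]

/-- The sum of the top coefficients, which makes `∏_b ℂ[X] / (X^{k_b+1})` a Frobenius algebra. -/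
def blockForm (k : Fin K → ℕ) : (∀ b, TruncPoly (k b)) →ₗ[ℂ] ℂ :=
  ∑ b, TruncPoly.topCoeff.comp (LinearMap.proj b)

theorem blockForm_apply (k : Fin K → ℕ) (f : ∀ b, TruncPoly (k b)) :
    blockForm k f = ∑ b, TruncPoly.topCoeff (f b) := by
  simp [blockForm]

theorem eq_zero_of_blockForm_mul (k : Fin K → ℕ) (f : ∀ b, TruncPoly (k b))
    (h : ∀ g, blockForm k (f * g) = 0) : f = 0 := by
  funext b
  refine TruncPoly.eq_zero_of_topCoeff_mul fun g => ?_
  have key := h (Pi.single b g)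
  rw [blockForm_apply, Finset.sum_eq_single b] at key
  · simpa using key
  · intro c _ hc
    simp [Pi.single_eq_of_ne hc]
  · simp

theorem pairing_stateSumE_eq_blockForm (k : Fin K → ℕ) (v : Fin n → BlockIdx k → ℂ) :
    pairing v (stateSumE n k) = blockForm k (∏ p, blockEquiv k (v p)) := by
  simp only [pairing_stateSumE, blockForm_apply, Finset.prod_apply, blockEquiv_apply,
    pairing_stateE, TruncPoly.topCoeff_prod_coeffEquiv]

/-- The action of an invertible matrix on row vectors. -/
def vecMulEquiv {ι : Type} [Fintype ι] [DecidableEq ι] (A : GL ι ℂ) : (ι → ℂ) ≃ₗ[ℂ] (ι → ℂ) :=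
  LinearEquiv.ofLinearMap (Matrix.vecMulLinear A.val) (Matrix.vecMulLinear A⁻¹.val)
    (LinearMap.ext fun v => by simp [Matrix.vecMul_vecMul, -Matrix.coe_units_inv])
    (LinearMap.ext fun v => by simp [Matrix.vecMul_vecMul, -Matrix.coe_units_inv])

theorem exists_perm_of_localOp_stateSumE (hn : 3 ≤ n) (k : Fin K → ℕ) (A : Fin n → GL (BlockIdx k) ℂ)
    (c : ℂ) (h : (localOp A).val (stateSumE n k) = c • stateSumE n k) :
    ∃ σ : Equiv.Perm (Fin K), (∀ b, k (σ b) = k b) ∧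
      ∀ p b d, d ≠ σ b → ∀ i j, (A p).val ⟨b, i⟩ ⟨d, j⟩ = 0 := by
  let B : Fin n → (∀ b, TruncPoly (k b)) ≃ₗ[ℂ] ∀ b, TruncPoly (k b) := fun p =>
    (blockEquiv k).symm.trans ((vecMulEquiv (A p)).trans (blockEquiv k))
  have hB : ∀ p v, B p (blockEquiv k v) = blockEquiv k (Matrix.vecMul v (A p).val) := by
    intro p v
    simp only [B, LinearEquiv.trans_apply, LinearEquiv.symm_apply_apply]
    rfl
  obtain ⟨θ, u, hθ⟩ := exists_algEquiv_of_preserves_form hn (blockForm k)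
    (eq_zero_of_blockForm_mul k) c B fun r => by
      obtain ⟨v, rfl⟩ : ∃ v : Fin n → BlockIdx k → ℂ, (fun p => blockEquiv k (v p)) = r :=
        ⟨fun p => (blockEquiv k).symm (r p), by simp⟩
      simp only [hB]
      rw [← pairing_stateSumE_eq_blockForm, ← pairing_stateSumE_eq_blockForm, ← pairing_localOp, h,
        map_smul, smul_eq_mul]
  obtain ⟨σ, hσ⟩ := exists_perm_of_algEquiv_pi
    (fun b => TruncPoly.eq_zero_or_one_of_mul_self (k := k b)) θ
  refine ⟨σ, ?_, ?_⟩
  -- A permutation preserves the total of the `k b`, so these inequalities must all be equalities.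
  · have hle : ∀ b ∈ Finset.univ, k b ≤ k (σ b) := by
      intro b _
      have := finrank_le_of_algEquiv_pi θ (hσ b)
      rw [TruncPoly.finrank_eq, TruncPoly.finrank_eq] at this
      omega
    have := (Finset.sum_eq_sum_iff_of_le hle).mp (Equiv.sum_comp σ k).symm
    exact fun b => (this b (Finset.mem_univ b)).symm
  · intro p b d hd i j
    have key := congrFun (hB p (Pi.single ⟨b, i⟩ 1)) d
    rw [blockEquiv_single, hθ, Pi.mul_apply, algEquiv_pi_single_apply_ne θ (hσ b) _ hd, mul_zero,
      blockEquiv_apply, eq_comm, map_eq_zero_iff _ TruncPoly.coeffEquiv.injective] at key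
    simpa using congrFun key j

/-- Since `N` has no off-diagonal blocks, the diagonal blocks of `N⁻¹` invert those of `N`. -/
theorem exists_blockSum_eq (k : Fin K → ℕ) (N : GL (BlockIdx k) ℂ)
    (hN : ∀ b d, d ≠ b → ∀ i j, N.val ⟨b, i⟩ ⟨d, j⟩ = 0) :
    ∃ S : ∀ b, GL (Fin (k b + 1)) ℂ, N = blockSum k S := by
  let M : ∀ b, Matrix (Fin (k b + 1)) (Fin (k b + 1)) ℂ := fun b i j => N.val ⟨b, i⟩ ⟨b, j⟩
  let M' : ∀ b, Matrix (Fin (k b + 1)) (Fin (k b + 1)) ℂ := fun b i j => N⁻¹.val ⟨b, i⟩ ⟨b, j⟩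
  have hM : ∀ b, M b * M' b = 1 := by
    intro b
    ext i j
    have key := congrFun (congrFun N.mul_inv ⟨b, i⟩) ⟨b, j⟩
    rw [Matrix.mul_apply, Fintype.sum_sigma, Finset.sum_eq_single b] at key
    · rw [Matrix.mul_apply, key]
      simp [Matrix.one_apply]
    · intro d _ hd
      simp [hN b d hd]
    · simp
  refine ⟨fun b => ⟨M b, M' b, hM b, mul_eq_one_comm.mp (hM b)⟩, Units.ext ?_⟩
  ext ⟨b, i⟩ ⟨d, j⟩
  have hval : ∀ S : ∀ b, GL (Fin (k b + 1)) ℂ,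
      (blockSum k S).val = Matrix.blockDiagonal' fun b => (S b).val := fun _ => rfl
  rw [hval]
  by_cases hd : d = b
  · subst hd
    rw [Matrix.blockDiagonal'_apply_eq]
  · rw [hN b d hd, Matrix.blockDiagonal'_apply_ne _ _ _ (Ne.symm hd)]

theorem mul_permGL_apply {ι : Type} [Fintype ι] [DecidableEq ι] (A : GL ι ℂ) (π : Equiv.Perm ι)
    (x y : ι) : (A * permGL π).val x y = A.val x (π y) := by
  simp [permGL, Matrix.mul_apply]

/-- Right multiplication by the permutation matrix brings the column block `σ b` back to `b`, making
every factor block diagonal. The permutation fixes the state, so the factor `c` is unchanged. -/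
theorem eq_directSum_mul_permutation (hn : 3 ≤ n) (k : Fin K → ℕ) (c : ℂˣ)
    {T : LinearMap.GeneralLinearGroup ℂ (Space n (BlockIdx k))} (hT : T ∈ (localOp (n := n)).range)
    (h : T.val (stateSumE n k) = (c : ℂ) • stateSumE n k) :
    ∃ D ∈ directSums n k c, ∃ P ∈ permutations n k, T = D * P⁻¹ := by
  obtain ⟨A, rfl⟩ := hT
  obtain ⟨σ, hσ, hA⟩ := exists_perm_of_localOp_stateSumE hn k A c h
  let P : GL (BlockIdx k) ℂ := permGL (blockPerm k σ hσ)
  have hP := permutations_stateSumE (n := n) k σ hσ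
  have ex : ∀ p, ∃ S : ∀ b, GL (Fin (k b + 1)) ℂ, A p * P = blockSum k S := by
    intro p
    refine exists_blockSum_eq k _ fun b d hd i j => ?_
    rw [mul_permGL_apply]
    exact hA p b (σ d) (fun e => hd (σ.injective e)) _ _
  choose S hS using ex
  have hmul : (localOp fun p => blockSum k (S p)) = localOp A * localOp fun _ => P := by
    rw [← map_mul]
    exact congrArg localOp (funext fun p => (hS p).symm)
  refine ⟨_, ⟨fun b p => S p b, ?_, rfl⟩, localOp fun _ => P, ⟨σ, hσ, rfl⟩, ?_⟩
  · rw [← localOp_blockSum_stateSumE_iff (by omega)]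
    change (localOp fun p => blockSum k (S p)).val _ = _
    rw [hmul, Units.val_mul, Module.End.mul_apply, hP, h]
  · exact eq_mul_inv_of_mul_eq hmul.symm

theorem apply_stateSumE_of_mem_directSums (hn : n ≠ 0) (k : Fin K → ℕ) (c : ℂˣ)
    {T : LinearMap.GeneralLinearGroup ℂ (Space n (BlockIdx k))} (hT : T ∈ directSums n k c) :
    T.val (stateSumE n k) = (c : ℂ) • stateSumE n k := by
  obtain ⟨S, hS, rfl⟩ := hT
  exact (localOp_blockSum_stateSumE_iff hn k S c).mpr hS

theorem directSums_subset_range (k : Fin K → ℕ) (c : ℂˣ) :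
    directSums n k c ⊆ (localOp (n := n) (ι := BlockIdx k)).range := by
  rintro T ⟨S, -, rfl⟩
  exact ⟨_, rfl⟩

theorem permutations_subset_stabilizer (k : Fin K → ℕ) :
    permutations n k ⊆ stabilizer (stateSumE n k) := by
  rintro T ⟨σ, hσ, rfl⟩
  exact ⟨⟨_, rfl⟩, permutations_stateSumE k σ hσ⟩

theorem stabilizer_le_symmetryGroup {ι : Type} [Fintype ι] [DecidableEq ι] (ψ : Space n ι) :
    stabilizer ψ ≤ symmetryGroup ψ :=
  fun _ hT => ⟨hT.1, 1, by simpa using hT.2⟩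

end Symmetries
end ESState
end

/-- The symmetries of `⨁_b |E_{k_b}⟩`, both up to a proportionality factor and with proportionality
factor one, are generated by the three kinds of operators. -/
theorem theorem7 (n : ℕ) (hn : 3 ≤ n) (K : ℕ) (k : Fin K → ℕ) :
    ESState.symmetryGroup (ESState.stateSumE n k) =
        Subgroup.closure
          ((⋃ α : ℂˣ, ESState.directSums n k α) ∪ (⋃ c : ℂˣ, ESState.scalings n k c) ∪
            ESState.permutations n k) ∧
      ESState.stabilizer (ESState.stateSumE n k) =
        Subgroup.closure
          (ESState.directSums n k 1 ∪ ESState.scalings n k 1 ∪ ESState.permutations n k) := by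
  have hn0 : n ≠ 0 := by omega
  have hdir : ∀ α, ESState.directSums n k α ⊆ ESState.symmetryGroup (ESState.stateSumE n k) :=
    fun α T hT => ⟨ESState.directSums_subset_range k α hT, α,
      ESState.apply_stateSumE_of_mem_directSums hn0 k α hT⟩
  have hdir1 : ESState.directSums n k 1 ⊆ ESState.stabilizer (ESState.stateSumE n k) :=
    fun T hT => ⟨ESState.directSums_subset_range k 1 hT, by
      simpa using ESState.apply_stateSumE_of_mem_directSums hn0 k 1 hT⟩
  constructor
  · refine le_antisymm ?_ ?_
    · rintro T ⟨hT, c, hc⟩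
      obtain ⟨D, hD, P, hP, rfl⟩ := ESState.eq_directSum_mul_permutation hn k c hT hc
      exact mul_mem
        (Subgroup.subset_closure (Or.inl (Or.inl (Set.mem_iUnion.mpr ⟨c, hD⟩))))
        (inv_mem (Subgroup.subset_closure (Or.inr hP)))
    · rw [Subgroup.closure_le]
      refine Set.union_subset (Set.union_subset ?_ ?_) ?_
      · exact Set.iUnion_subset hdir
      · exact Set.iUnion_subset fun c =>
          (ESState.scalings_subset_directSums k c).trans (hdir c)
      · exact (ESState.permutations_subset_stabilizer k).trans
          (ESState.stabilizer_le_symmetryGroup _)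
  · refine le_antisymm ?_ ?_
    · rintro T ⟨hT, h⟩
      obtain ⟨D, hD, P, hP, rfl⟩ :=
        ESState.eq_directSum_mul_permutation hn k 1 hT (by simpa using h)
      exact mul_mem (Subgroup.subset_closure (Or.inl (Or.inl hD)))
        (inv_mem (Subgroup.subset_closure (Or.inr hP)))
    · rw [Subgroup.closure_le]
      exact Set.union_subset (Set.union_subset hdir1
        ((ESState.scalings_subset_directSums k 1).trans hdir1))
        (ESState.permutations_subset_stabilizer k)
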